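/- Let $T$ be a principal ideal domain, $m\ge 1$, and $d_1,\dots,d_m\in T$ with $d_m\mid\cdots\mid d_2\mid d_1$, where $d_1$ is a nonzero non-unit and $R=T/\langle d_1\rangle$ is finite. Let $p_1,\dots,p_L$ be pairwise non-associated primes with $d_j=u_j\,p_1^{t_{1,j}}\cdots p_L^{t_{L,j}}$ ($u_j$ a unit, $t_{\ell,j}\ge 0$, $t_{\ell,1}\ge 1$). Put $R_\ell=T/\langle p_\ell^{t_{\ell,1}}\rangle$ (a finite chain ring) and $$\Omega=R\times (d_1/d_2)R\times\cdots\times(d_1/d_m)R\subseteq R^m,\qquad \Omega_\ell=R_\ell\times p_\ell^{t_{\ell,1}-t_{\ell,2}}R_\ell\times\cdots\times p_\ell^{t_{\ell,1}-t_{\ell,m}}R_\ell\subseteq R_\ell^m,$$ and let $X^{[\ell]}$ denote the entrywise projection of a matrix $X$ over $R$ to $R_\ell$. A matrix over $R_\ell$ has rank $t$ if its row span is isomorphic to $R_\ell^t$ as an $R_\ell$-module (its shape is $(t,\dots,t)$); a matrix $X$ over $R$ has rank $t$ if $X^{[\ell]}$ has rank $t$ for every $\ell$. A $k\times l$ matrix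 over $R$ or $R_\ell$ is full rank if it has rank $\min\{k,l\}$. Theorem. Let $N\ge n$. Let $A\in R^{N\times n}$ be uniform over all full-rank matrices and let $Z\in R^{N\times m}$ be uniform over all rank-$t$ matrices whose rows are from $\Omega$, with $A$ and $Z$ independent. Consider the channel $Y=AX+Z$, whose input $X$ is an $n\times m$ matrix with rows from $\Omega$, independent of $(A,Z)$, and whose output $Y$ is an $N\times m$ matrix with rows from $\Omega$, and its projections, the sub-channels $$Y^{[\ell]}=A^{[\ell]}X^{[\ell]}+Z^{[\ell]},\qquad \ell=1,\dots,L,$$ whose input and output matrices have rows from $\Omega_\ell$. Then: 1. For every $k$, the map $X\mapsto (X^{[1]},\dots,X^{[L]})$ is a bijection from the $k\times m$ matrices with rows from $\Omega$ onto the families of $k\times m$ matrices with rows from $\Omega_1,\dots,\Omega_L$ respectively, and $(AX+Z)^{[\ell]}=A^{[\ell]}X^{[\ell]}+Z^{[\ell]}$ for every $\ell$. 2. The pairs $(A^{[\ell]},Z^{[\ell]})$, $\ell=1,\dots,L$, are mutually independent. For every $\ell$, $A^{[\ell]}$ is uniform over the full-rank matrices in $R_\ell^{N\times n}$, $Z^{[\ell]}$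 is uniform over the rank-$t$ matrices in $R_\ell^{N\times m}$ whose rows are from $\Omega_\ell$, and $A^{[\ell]}$ is independent of $Z^{[\ell]}$. 3. The channel and the sub-channels are discrete memoryless channels, and under the bijection of part 1 the channel is the product of the sub-channels: $\Pr(AX+Z=Y)=\prod_{\ell=1}^L \Pr(A^{[\ell]}X^{[\ell]}+Z^{[\ell]}=Y^{[\ell]})$. 4. Let $C$ and $C_\ell$ be the capacities of the channel and of the $\ell$-th sub-channel, i.e. the maxima of the mutual information between input and output over all input distributions (these maxima are attained; all logarithms are natural, another common base rescales all capacities). Then the product channel has capacity $C$, and $C=\sum_{\ell=1}^L C_\ell$. -/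

import Mathlib

open MeasureTheory ProbabilityTheory

noncomputable section

/-! ### Discrete memoryless channels with finite alphabets -/

/-- The mutual information (in nats) of two random variables with joint distribution `q`. -/
def mutualInformation {α β : Type*} [Fintype α] [Fintype β] (q : α → β → ℝ) : ℝ :=
  ∑ x, ∑ y, q x y * Real.log (q x y / ((∑ y', q x y') * (∑ x', q x' y)))

/-- `W x y` is a family of transition probabilities `p(y | x)`. -/
def IsDMC {α β : Type*} [Fintype β] (W : α → β → ℝ) : Prop :=
  (∀ x y, 0 ≤ W x y) ∧ ∀ x, ∑ y, W x y = 1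

/-- All values of `I(X; Y)`, over all input distributions `p` on the input alphabet. -/
def informationValues {α β : Type*} [Fintype α] [Fintype β] (W : α → β → ℝ) : Set ℝ :=
  (fun p : α → ℝ => mutualInformation (fun x y => p x * W x y)) '' stdSimplex ℝ α

/-- The capacity `max_p I(X; Y)`, as a supremum. -/
def channelCapacity {α β : Type*} [Fintype α] [Fintype β] (W : α → β → ℝ) : ℝ :=
  sSup (informationValues W)

/-- The product of a finite family of channels. -/
def productChannel {ι : Type*} [Fintype ι] {α β : ι → Type*} (W : ∀ i, α i → β i → ℝ) :
    (∀ i, α i) → (∀ i, β i) → ℝ :=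
  fun x y => ∏ i, W i (x i) (y i)

/-! ### Random matrices -/

/-- Matrices carry the discrete σ-algebra (they have entries in finite rings below). -/
instance matrixMeasurableSpace {k l R : Type*} : MeasurableSpace (Matrix k l R) := ⊤

/-- The random element `V` is uniformly distributed over the set `s`. -/
def IsUniformlyDistributed {W α : Type*} [MeasurableSpace W] [MeasurableSpace α]
    (P : Measure W) (V : W → α) (s : Set α) : Prop :=
  Measurable V ∧ P.map V = uniformOn s

/-- The matrices with `k` rows, all of which lie in `M`. -/
def matricesOver {R : Type*} [CommRing R] {m : ℕ} (M : Submodule R (Fin m → R)) (k : ℕ) :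
    Set (Matrix (Fin k) (Fin m) R) :=
  {X | ∀ i, X.row i ∈ M}

instance matricesOverFintype {R : Type*} [CommRing R] [Finite R] {m : ℕ}
    (M : Submodule R (Fin m → R)) (k : ℕ) : Fintype (matricesOver M k) :=
  have : Finite (Matrix (Fin k) (Fin m) R) := inferInstanceAs (Finite (Fin k → Fin m → R))
  Fintype.ofFinite _

/-- The channel `Y = A X + Z`, with `X` independent of `(A, Z)` and with the rows of `X` and `Y`
in `M`: the transition probability `p(Y | X)` is the probability that `A X + Z = Y`. -/
def matrixChannel {R : Type*} [CommRing R] {m N n : ℕ} {W : Type*} [MeasurableSpace W]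
    (M : Submodule R (Fin m → R)) (P : Measure W) (A : W → Matrix (Fin N) (Fin n) R)
    (Z : W → Matrix (Fin N) (Fin m) R) : matricesOver M n → matricesOver M N → ℝ :=
  fun X Y => P.real {w | A w * X.1 + Z w = Y.1}

/-- Rank over a finite chain ring: `A` has rank `t` if its row span has the shape `(t, …, t)`,
i.e. is isomorphic to `R ^ t`. (Not every matrix has a rank.) -/
def HasChainRank {R : Type*} [CommRing R] {k l : ℕ} (A : Matrix (Fin k) (Fin l) R) (t : ℕ) :
    Prop :=
  Nonempty (Submodule.span R (Set.range A.row) ≃ₗ[R] (Fin t → R))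

/-! ### The message space and its decomposition -/

/-- For `b j ∣ a`, the submodule `(a / b 0) R × ⋯ × (a / b (m - 1)) R` of `R ^ m`, where
`R = T / ⟨a⟩`; it is a copy of `T / ⟨b 0⟩ × ⋯ × T / ⟨b (m - 1)⟩`. -/
def packetModule {T : Type*} [CommRing T] {m : ℕ} (a : T) (b : Fin m → T) :
    Submodule (T ⧸ Ideal.span {a}) (Fin m → T ⧸ Ideal.span {a}) :=
  Submodule.pi Set.univ fun j =>
    Ideal.span {r | ∃ c : T, c * b j = a ∧ r = Ideal.Quotient.mk (Ideal.span {a}) c}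

/-- The data of a message space `T / ⟨d 0⟩ × ⋯ × T / ⟨d (m - 1)⟩` with
`d (m - 1) ∣ ⋯ ∣ d 1 ∣ d 0`, together with prime factorizations
`d j = (unit) * ∏ ℓ, p ℓ ^ e ℓ j`. -/
structure MessageSpace (T : Type*) [CommRing T] (m L : ℕ) [NeZero m] where
  d : Fin m → T
  p : Fin L → T
  e : Fin L → Fin m → ℕ
  d_zero_ne_zero : d 0 ≠ 0
  d_zero_not_isUnit : ¬ IsUnit (d 0)
  d_dvd : ∀ i j, i ≤ j → d j ∣ d i
  finite_quotient : Finite (T ⧸ Ideal.span {d 0})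
  prime_p : ∀ ℓ, Prime (p ℓ)
  not_associated : ∀ ℓ ℓ', ℓ ≠ ℓ' → ¬ Associated (p ℓ) (p ℓ')
  e_zero_pos : ∀ ℓ, 0 < e ℓ 0
  associated_prod : ∀ j, Associated (d j) (∏ ℓ, p ℓ ^ e ℓ j)

namespace MessageSpace

variable {T : Type*} [CommRing T] {m L : ℕ} [NeZero m] (S : MessageSpace T m L)

/-- The ring `R = T / ⟨d 0⟩`. -/
abbrev R : Type _ := T ⧸ Ideal.span {S.d 0}

/-- The chain ring `R_ℓ = T / ⟨p ℓ ^ e ℓ 0⟩`. -/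
abbrev chainRing (ℓ : Fin L) : Type _ := T ⧸ Ideal.span {S.p ℓ ^ S.e ℓ 0}

theorem span_le (ℓ : Fin L) :
    Ideal.span {S.d 0} ≤ Ideal.span {S.p ℓ ^ S.e ℓ 0} :=
  Ideal.span_singleton_le_span_singleton.2
    ((Finset.dvd_prod_of_mem (fun i => S.p i ^ S.e i 0) (Finset.mem_univ ℓ)).trans
      (S.associated_prod 0).symm.dvd)

/-- The projection `R → R_ℓ`. -/
def proj (ℓ : Fin L) : S.R →+* S.chainRing ℓ := Ideal.Quotient.factor (S.span_le ℓ)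

instance finite_R : Finite S.R := S.finite_quotient

instance finite_chainRing (ℓ : Fin L) : Finite (S.chainRing ℓ) :=
  Finite.of_surjective (S.proj ℓ) (Ideal.Quotient.factor_surjective (S.span_le ℓ))

/-- The message space, as a submodule of `R ^ m`. -/
def Ω : Submodule S.R (Fin m → S.R) := packetModule (S.d 0) S.d

/-- The `ℓ`-th component of the message space, as a submodule of `R_ℓ ^ m`. -/
def ΩSub (ℓ : Fin L) : Submodule (S.chainRing ℓ) (Fin m → S.chainRing ℓ) :=
  packetModule (S.p ℓ ^ S.e ℓ 0) (fun j => S.p ℓ ^ S.e ℓ j)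

/-- The projection `X^[ℓ]` of a matrix `X` over `R`. -/
def projMatrix (ℓ : Fin L) {k l : ℕ} (X : Matrix (Fin k) (Fin l) S.R) :
    Matrix (Fin k) (Fin l) (S.chainRing ℓ) :=
  X.map (S.proj ℓ)

/-- A matrix over `R` has rank `t` if all its projections have rank `t`. -/
def HasRank {k l : ℕ} (X : Matrix (Fin k) (Fin l) S.R) (t : ℕ) : Prop :=
  ∀ ℓ, HasChainRank (S.projMatrix ℓ X) t

end MessageSpace

end

noncomputable section

/-! ### Mutual information of a channel in terms of entropies -/

theorem sum_output_eq_one {α β : Type*} [Fintype α] [Fintype β] {W : α → β → ℝ} (hW : IsDMC W)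
    {p : α → ℝ} (hp : p ∈ stdSimplex ℝ α) : ∑ y, ∑ x, p x * W x y = 1 := by
  rw [Finset.sum_comm]
  simp [← Finset.mul_sum, hW.2, hp.2]

theorem mutualInformation_eq_entropy_sub {α β : Type*} [Fintype α] [Fintype β] {W : α → β → ℝ}
    (hW : IsDMC W) {p : α → ℝ} (hp : ∀ x, 0 ≤ p x) :
    mutualInformation (fun x y => p x * W x y) =
      ∑ y, Real.negMulLog (∑ x, p x * W x y) - ∑ x, p x * ∑ y, Real.negMulLog (W x y) := by
  have key : ∀ x y, p x * W x y *
      Real.log (p x * W x y / ((∑ y', p x * W x y') * (∑ x', p x' * W x' y))) =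
      -(p x * W x y * Real.log (∑ x', p x' * W x' y)) - p x * Real.negMulLog (W x y) := by
    intro x y
    rw [← Finset.mul_sum, hW.2, mul_one]
    rcases (hp x).eq_or_lt with h | h
    · simp [← h]
    rcases (hW.1 x y).eq_or_lt with h' | h'
    · simp [← h']
    have ho : 0 < ∑ x', p x' * W x' y := (mul_pos h h').trans_le
      (Finset.single_le_sum (f := fun x' => p x' * W x' y)
        (fun x' _ => mul_nonneg (hp x') (hW.1 x' y)) (Finset.mem_univ x))
    rw [mul_div_mul_left _ _ h.ne', Real.log_div h'.ne' ho.ne', Real.negMulLog]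
    ring
  calc mutualInformation (fun x y => p x * W x y)
      = ∑ x, ∑ y, (-(p x * W x y * Real.log (∑ x', p x' * W x' y)) -
          p x * Real.negMulLog (W x y)) :=
        Finset.sum_congr rfl fun x _ => Finset.sum_congr rfl fun y _ => key x y
    _ = _ := by
        simp only [Finset.sum_sub_distrib, ← Finset.mul_sum]
        rw [Finset.sum_comm]
        simp only [Real.negMulLog, Finset.sum_neg_distrib, ← Finset.sum_mul, neg_mul]

theorem isGreatest_channelCapacity {α β : Type*} [Fintype α] [Fintype β] [Nonempty α]
    {W : α → β → ℝ} (hW : IsDMC W) : IsGreatest (informationValues W) (channelCapacity W) := by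
  classical
  have hc : IsCompact (informationValues W) := by
    refine (isCompact_stdSimplex ℝ α).image_of_continuousOn ?_
    have hcont : Continuous fun p : α → ℝ =>
        ∑ y, Real.negMulLog (∑ x, p x * W x y) - ∑ x, p x * ∑ y, Real.negMulLog (W x y) := by
      refine .sub (continuous_finsetSum _ fun y _ => ?_) (by fun_prop)
      exact Real.continuous_negMulLog.comp (by fun_prop)
    exact hcont.continuousOn.congr fun p hp => mutualInformation_eq_entropy_sub hW hp.1
  have hne : (informationValues W).Nonempty :=
    Set.Nonempty.image _ ⟨_, single_mem_stdSimplex ℝ (Classical.arbitrary α)⟩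
  exact hc.isGreatest_sSup hne

theorem mutualInformation_equiv {α α' β β' : Type*} [Fintype α] [Fintype α'] [Fintype β]
    [Fintype β'] (e : α ≃ α') (f : β ≃ β') (q : α' → β' → ℝ) :
    mutualInformation (fun x y => q (e x) (f y)) = mutualInformation q := by
  simp only [mutualInformation]
  rw [← e.sum_comp]
  refine Finset.sum_congr rfl fun x _ => ?_
  rw [← f.sum_comp]
  refine Finset.sum_congr rfl fun y _ => ?_
  rw [f.sum_comp (q (e x)), e.sum_comp (fun x' => q x' (f y))]

theorem informationValues_equiv {α α' β β' : Type*} [Fintype α] [Fintype α'] [Fintype β]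
    [Fintype β'] (e : α ≃ α') (f : β ≃ β') (V : α' → β' → ℝ) :
    informationValues (fun x y => V (e x) (f y)) = informationValues V := by
  ext v
  constructor
  · rintro ⟨p, hp, rfl⟩
    refine ⟨fun x => p (e.symm x), ⟨fun x => hp.1 _, ?_⟩, ?_⟩
    · rw [e.symm.sum_comp p]; exact hp.2
    · simp only
      rw [← mutualInformation_equiv e f]
      simp
  · rintro ⟨p, hp, rfl⟩
    refine ⟨fun x => p (e x), ⟨fun x => hp.1 _, ?_⟩, ?_⟩
    · rw [e.sum_comp p]; exact hp.2
    · exact mutualInformation_equiv e f fun x y => p x * V x y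

/-! ### Marginals and entropies on finite product spaces -/

theorem negMulLog_prod_eq_sum {ι : Type*} [Fintype ι] {β : ι → Type*} (q : ∀ i, β i → ℝ) (y : ∀ i, β i) :
    Real.negMulLog (∏ j, q j (y j)) = ∑ i, (∏ j, q j (y j)) * -Real.log (q i (y i)) := by
  by_cases h : ∏ j, q j (y j) = 0
  · simp [h]
  · rw [Real.negMulLog, Real.log_prod fun i _ => (Finset.prod_ne_zero_iff.1 h) i (Finset.mem_univ i),
      ← Finset.mul_sum, Finset.sum_neg_distrib]
    ring

section Marginal

variable {ι : Type*} [Fintype ι] [DecidableEq ι] {β : ι → Type*} [∀ i, Fintype (β i)]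

/-- The `i`-th marginal of a mass function on a finite product. -/
def massMarginal (q : (∀ i, β i) → ℝ) (i : ι) (b : β i) : ℝ :=
  open Classical in ∑ y, if y i = b then q y else 0

theorem sum_massMarginal_mul (q : (∀ i, β i) → ℝ) (i : ι) (g : β i → ℝ) :
    ∑ b, massMarginal q i b * g b = ∑ y, q y * g (y i) := by
  classical
  simp only [massMarginal, Finset.sum_mul]
  rw [Finset.sum_comm]
  refine Finset.sum_congr rfl fun y _ => ?_
  simp [ite_mul]

theorem massMarginal_mem_stdSimplex {q : (∀ i, β i) → ℝ} (hq : q ∈ stdSimplex ℝ (∀ i, β i))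
    (i : ι) : massMarginal q i ∈ stdSimplex ℝ (β i) := by
  refine ⟨fun b => Finset.sum_nonneg fun y _ => ?_, ?_⟩
  · split_ifs
    exacts [hq.1 y, le_rfl]
  · simpa [hq.2] using sum_massMarginal_mul q i fun _ => 1

theorem massMarginal_pos {q : (∀ i, β i) → ℝ} (hq : ∀ y, 0 ≤ q y) {y : ∀ i, β i} (hy : 0 < q y)
    (i : ι) : 0 < massMarginal q i (y i) := by
  classical
  refine hy.trans_le ?_
  simpa [massMarginal] using Finset.single_le_sum (f := fun z => if z i = y i then q z else 0)
    (fun z _ => by split_ifs; exacts [hq z, le_rfl]) (Finset.mem_univ y)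

theorem prod_mem_stdSimplex {q : ∀ i, β i → ℝ} (hq : ∀ i, q i ∈ stdSimplex ℝ (β i)) :
    (fun y : ∀ i, β i => ∏ i, q i (y i)) ∈ stdSimplex ℝ (∀ i, β i) := by
  refine ⟨fun y => Finset.prod_nonneg fun i _ => (hq i).1 _, ?_⟩
  rw [← Fintype.prod_sum]
  simp [(hq _).2]

theorem sum_prod_mul_apply {q : ∀ i, β i → ℝ} (hq : ∀ i, ∑ b, q i b = 1) (i : ι) (g : β i → ℝ) :
    ∑ y : ∀ i, β i, (∏ j, q j (y j)) * g (y i) = ∑ b, q i b * g b := by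
  have h : ∀ y : ∀ i, β i, (∏ j, q j (y j)) * g (y i) =
      ∏ j, Function.update q i (fun b => q i b * g b) j (y j) := by
    intro y
    rw [← Finset.mul_prod_erase _ _ (Finset.mem_univ i),
      ← Finset.mul_prod_erase (a := i) _ _ (Finset.mem_univ i), Function.update_self, mul_right_comm]
    congr 1
    exact Finset.prod_congr rfl fun j hj => by rw [Function.update_of_ne (Finset.ne_of_mem_erase hj)]
  simp only [h]
  rw [← Fintype.prod_sum, ← Finset.mul_prod_erase _ _ (Finset.mem_univ i), Function.update_self,
    Finset.prod_eq_one, mul_one]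
  intro j hj
  rw [Function.update_of_ne (Finset.ne_of_mem_erase hj), hq]

theorem massMarginal_prod {q : ∀ i, β i → ℝ} (hq : ∀ i, ∑ b, q i b = 1) (i : ι) :
    massMarginal (fun y : ∀ i, β i => ∏ j, q j (y j)) i = q i := by
  classical
  ext b
  simpa [massMarginal] using sum_prod_mul_apply hq i fun c => if c = b then 1 else 0

theorem entropy_prod {q : ∀ i, β i → ℝ} (hq : ∀ i, ∑ b, q i b = 1) :
    ∑ y : ∀ i, β i, Real.negMulLog (∏ i, q i (y i)) = ∑ i, ∑ b, Real.negMulLog (q i b) := by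
  simp only [negMulLog_prod_eq_sum]
  rw [Finset.sum_comm]
  refine Finset.sum_congr rfl fun i _ => ?_
  rw [sum_prod_mul_apply hq i fun b => -Real.log (q i b)]
  exact Finset.sum_congr rfl fun b _ => by rw [Real.negMulLog]; ring

theorem entropy_le_sum_entropy_massMarginal {q : (∀ i, β i) → ℝ}
    (hq : q ∈ stdSimplex ℝ (∀ i, β i)) :
    ∑ y, Real.negMulLog (q y) ≤ ∑ i, ∑ b, Real.negMulLog (massMarginal q i b) := by
  have hm := massMarginal_mem_stdSimplex hq
  have hr : ∑ y : ∀ i, β i, ∏ i, massMarginal q i (y i) = 1 := (prod_mem_stdSimplex hm).2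
  have hsum : ∑ i, ∑ b, Real.negMulLog (massMarginal q i b) =
      ∑ y, ∑ i, q y * -Real.log (massMarginal q i (y i)) := by
    rw [Finset.sum_comm]
    refine Finset.sum_congr rfl fun i _ => ?_
    rw [← sum_massMarginal_mul q i fun b => -Real.log (massMarginal q i b)]
    exact Finset.sum_congr rfl fun b _ => by rw [Real.negMulLog]; ring
  have key : ∀ y, Real.negMulLog (q y) ≤ ∑ i, q y * -Real.log (massMarginal q i (y i)) +
      (∏ i, massMarginal q i (y i) - q y) := by
    intro y
    rcases (hq.1 y).eq_or_lt with h | h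
    · simpa [← h] using Finset.prod_nonneg fun i _ => (hm i).1 (y i)
    have hpos : ∀ i, 0 < massMarginal q i (y i) := massMarginal_pos hq.1 h
    have hprod : 0 < ∏ i, massMarginal q i (y i) := Finset.prod_pos fun i _ => hpos i
    have hlog := Real.log_le_sub_one_of_pos (div_pos hprod h)
    rw [Real.log_div hprod.ne' h.ne', Real.log_prod fun i _ => (hpos i).ne'] at hlog
    have := mul_le_mul_of_nonneg_left hlog h.le
    rw [mul_sub, mul_sub, mul_div_cancel₀ _ h.ne'] at this
    rw [← Finset.mul_sum, Finset.sum_neg_distrib, Real.negMulLog]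
    linarith
  calc ∑ y, Real.negMulLog (q y)
      ≤ ∑ y, (∑ i, q y * -Real.log (massMarginal q i (y i)) +
          (∏ i, massMarginal q i (y i) - q y)) := Finset.sum_le_sum fun y _ => key y
    _ = ∑ i, ∑ b, Real.negMulLog (massMarginal q i b) := by
      rw [Finset.sum_add_distrib, Finset.sum_sub_distrib, hr, hq.2, hsum]
      simp

end Marginal

/-! ### The capacity of a product channel -/

theorem isDMC_productChannel {ι : Type*} [Fintype ι] [DecidableEq ι] {α β : ι → Type*}
    [∀ i, Fintype (β i)] {W : ∀ i, α i → β i → ℝ} (hW : ∀ i, IsDMC (W i)) : IsDMC (productChannel W) := by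
  refine ⟨fun x y => Finset.prod_nonneg fun i _ => (hW i).1 _ _, fun x => ?_⟩
  simp only [productChannel]
  rw [← Fintype.prod_sum fun i b => W i (x i) b]
  simp [(hW _).2]

section Product

variable {ι : Type*} [Fintype ι] [DecidableEq ι] {α β : ι → Type*} [∀ i, Fintype (α i)]
  [∀ i, Fintype (β i)] {W : ∀ i, α i → β i → ℝ}

theorem output_mem_stdSimplex {α β : Type*} [Fintype α] [Fintype β] {W : α → β → ℝ}
    (hW : IsDMC W) {p : α → ℝ} (hp : p ∈ stdSimplex ℝ α) :
    (fun y => ∑ x, p x * W x y) ∈ stdSimplex ℝ β :=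
  ⟨fun y => Finset.sum_nonneg fun x _ => mul_nonneg (hp.1 x) (hW.1 x y), sum_output_eq_one hW hp⟩

theorem massMarginal_output (hW : ∀ i, IsDMC (W i)) (p : (∀ i, α i) → ℝ) (i : ι) (b : β i) :
    massMarginal (fun y => ∑ x, p x * productChannel W x y) i b =
      ∑ a, massMarginal p i a * W i a b := by
  classical
  rw [sum_massMarginal_mul p i fun a => W i a b]
  have h : ∀ x : ∀ i, α i,
      massMarginal (productChannel W x) i b = W i (x i) b := fun x =>
    congrFun (massMarginal_prod (q := fun i => W i (x i)) (fun i => (hW i).2 _) i) b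
  simp only [← h, massMarginal, Finset.mul_sum]
  rw [Finset.sum_comm]
  refine Finset.sum_congr rfl fun y _ => ?_
  split_ifs <;> simp

theorem sum_mul_entropy_productChannel (hW : ∀ i, IsDMC (W i)) (p : (∀ i, α i) → ℝ) :
    ∑ x, p x * ∑ y, Real.negMulLog (productChannel W x y) =
      ∑ i, ∑ a, massMarginal p i a * ∑ b, Real.negMulLog (W i a b) := by
  have h : ∀ x, ∑ y, Real.negMulLog (productChannel W x y) =
      ∑ i, ∑ b, Real.negMulLog (W i (x i) b) := fun x =>
    entropy_prod (q := fun i => W i (x i)) fun i => (hW i).2 _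
  simp only [h, Finset.mul_sum (s := (Finset.univ : Finset ι))]
  rw [Finset.sum_comm]
  exact Finset.sum_congr rfl fun i _ =>
    (sum_massMarginal_mul p i fun a => ∑ b, Real.negMulLog (W i a b)).symm

theorem mutualInformation_productChannel_le (hW : ∀ i, IsDMC (W i)) {p : (∀ i, α i) → ℝ}
    (hp : p ∈ stdSimplex ℝ (∀ i, α i)) :
    mutualInformation (fun x y => p x * productChannel W x y) ≤
      ∑ i, mutualInformation (fun x y => massMarginal p i x * W i x y) := by
  have hV := isDMC_productChannel hW
  have h := entropy_le_sum_entropy_massMarginal (output_mem_stdSimplex hV hp)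
  simp only [massMarginal_output hW] at h
  rw [mutualInformation_eq_entropy_sub hV hp.1, sum_mul_entropy_productChannel hW]
  simp only [fun i => mutualInformation_eq_entropy_sub (hW i) (massMarginal_mem_stdSimplex hp i).1,
    Finset.sum_sub_distrib]
  linarith

theorem mutualInformation_productChannel_prod (hW : ∀ i, IsDMC (W i)) {p : ∀ i, α i → ℝ}
    (hp : ∀ i, p i ∈ stdSimplex ℝ (α i)) :
    mutualInformation (fun x y => (∏ i, p i (x i)) * productChannel W x y) =
      ∑ i, mutualInformation (fun x y => p i x * W i x y) := by
  have hout : ∀ y, ∑ x : ∀ i, α i, (∏ i, p i (x i)) * productChannel W x y =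
      ∏ i, ∑ a, p i a * W i a (y i) := by
    intro y
    rw [Fintype.prod_sum fun i a => p i a * W i a (y i)]
    simp [productChannel, Finset.prod_mul_distrib]
  rw [mutualInformation_eq_entropy_sub (isDMC_productChannel hW) (prod_mem_stdSimplex hp).1,
    sum_mul_entropy_productChannel hW]
  simp only [hout, massMarginal_prod fun i => (hp i).2]
  rw [entropy_prod (q := fun i b => ∑ a, p i a * W i a b) fun i => sum_output_eq_one (hW i) (hp i),
    ← Finset.sum_sub_distrib]
  exact Finset.sum_congr rfl fun i _ => (mutualInformation_eq_entropy_sub (hW i) (hp i).1).symm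

theorem channelCapacity_productChannel [∀ i, Nonempty (α i)] (hW : ∀ i, IsDMC (W i)) :
    channelCapacity (productChannel W) = ∑ i, channelCapacity (W i) := by
  refine IsGreatest.csSup_eq ⟨?_, ?_⟩
  · choose p hp hpC using fun i => (isGreatest_channelCapacity (hW i)).1
    refine ⟨_, prod_mem_stdSimplex hp, ?_⟩
    simp only [mutualInformation_productChannel_prod hW hp, hpC]
  · rintro _ ⟨p, hp, rfl⟩
    exact (mutualInformation_productChannel_le hW hp).trans (Finset.sum_le_sum fun i _ =>
      (isGreatest_channelCapacity (hW i)).2 ⟨_, massMarginal_mem_stdSimplex hp i, rfl⟩)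

end Product

/-! ### Uniform distributions on finite sets -/

section Uniform

variable {W : Type*} [MeasurableSpace W] {P : Measure W}

theorem uniformOn_prod_eq {α β : Type*} [Finite α] [Finite β] [MeasurableSpace α]
    [MeasurableSpace β] [MeasurableSingletonClass α] [MeasurableSingletonClass β] (s : Set α)
    (t : Set β) : uniformOn (s ×ˢ t) = (uniformOn s).prod (uniformOn t) := by
  classical
  refine (Measure.prod_eq fun u v _ _ => ?_).symm
  lift s to Finset α using s.toFinite
  lift t to Finset β using t.toFinite
  lift u to Finset α using u.toFinite
  lift v to Finset β using v.toFinite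
  rw [← Finset.coe_product, ← Finset.coe_product, uniformOn_apply_finset, uniformOn_apply_finset,
    uniformOn_apply_finset, Finset.product_inter_product, Finset.card_product, Finset.card_product,
    Nat.cast_mul, Nat.cast_mul, ENNReal.mul_div_mul_comm] <;> simp

theorem uniformOn_pi_eq {ι : Type*} [Fintype ι] {β : ι → Type*} [∀ i, Finite (β i)]
    [∀ i, MeasurableSpace (β i)] [∀ i, MeasurableSingletonClass (β i)] (s : ∀ i, Set (β i)) :
    uniformOn (Set.univ.pi s) = Measure.pi fun i => uniformOn (s i) := by
  classical
  refine (Measure.pi_eq fun t _ => ?_).symm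
  lift s to ∀ i, Finset (β i) using fun i => (s i).toFinite
  lift t to ∀ i, Finset (β i) using fun i => (t i).toFinite
  simp [← Fintype.coe_piFinset, uniformOn_apply_finset, ← Fintype.piFinset_inter,
    ENNReal.prod_div_distrib_of_ne_top]

theorem IsUniformlyDistributed.nonempty [IsProbabilityMeasure P] {α : Type*} [MeasurableSpace α]
    {V : W → α} {s : Set α} (hV : IsUniformlyDistributed P V s) : s.Nonempty := by
  by_contra h
  have := Measure.isProbabilityMeasure_map (μ := P) hV.1.aemeasurable
  rw [Set.not_nonempty_iff_eq_empty] at h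
  rw [hV.2, h, uniformOn_empty_meas] at this
  exact IsProbabilityMeasure.ne_zero (0 : Measure α) rfl

theorem IsUniformlyDistributed.ae_mem [IsProbabilityMeasure P] {α : Type*} [Finite α]
    [MeasurableSpace α] [MeasurableSingletonClass α]
    {V : W → α} {s : Set α} (hV : IsUniformlyDistributed P V s) : ∀ᵐ w ∂P, V w ∈ s := by
  have h : ∀ᵐ a ∂(P.map V), a ∈ s := by
    rw [hV.2]
    exact (uniformOn_eq_zero_iff s.toFinite).2 (Set.inter_compl_self s)
  exact ae_of_ae_map hV.1.aemeasurable h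

theorem IsUniformlyDistributed.comp_bijective {α β : Type*} [Finite α] [MeasurableSpace α]
    [MeasurableSingletonClass α] [MeasurableSpace β] [MeasurableSingletonClass β]
    {V : W → α} {f : α → β} (hf : f.Bijective) {s : Set β}
    (hV : IsUniformlyDistributed P V (f ⁻¹' s)) :
    IsUniformlyDistributed P (fun w => f (V w)) s := by
  have hfm : Measurable f := measurable_of_finite f
  refine ⟨hfm.comp hV.1, ?_⟩
  have := Finite.of_surjective f hf.2
  change P.map (f ∘ V) = _
  rw [← Measure.map_map hfm hV.1, hV.2]
  have hc : ∀ u : Set β, Measure.count (f ⁻¹' u) = Measure.count u := fun u => by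
    rw [Measure.count_apply (f ⁻¹' u).toFinite.measurableSet,
      Measure.count_apply u.toFinite.measurableSet, Set.encard_preimage_of_bijective hf]
  ext u hu
  rw [Measure.map_apply hfm hu, uniformOn, uniformOn, cond_apply (Set.toFinite _).measurableSet,
    cond_apply (Set.toFinite _).measurableSet, ← Set.preimage_inter, hc, hc]

theorem IsUniformlyDistributed.prodMk {α β : Type*} [Finite α] [Finite β] [MeasurableSpace α]
    [MeasurableSpace β] [MeasurableSingletonClass α] [MeasurableSingletonClass β]
    [IsProbabilityMeasure P] {U : W → α} {V : W → β} {s : Set α} {t : Set β}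
    (hU : IsUniformlyDistributed P U s) (hV : IsUniformlyDistributed P V t)
    (h : IndepFun U V P) : IsUniformlyDistributed P (fun w => (U w, V w)) (s ×ˢ t) := by
  refine ⟨hU.1.prodMk hV.1, ?_⟩
  rw [(indepFun_iff_map_prod_eq_prod_map_map hU.1.aemeasurable hV.1.aemeasurable).1 h, hU.2, hV.2,
    uniformOn_prod_eq]

theorem IsUniformlyDistributed.components [IsProbabilityMeasure P] {ι α : Type*} [Fintype ι]
    {β : ι → Type*} [Finite α] [MeasurableSpace α] [MeasurableSingletonClass α]
    [∀ i, Finite (β i)] [∀ i, MeasurableSpace (β i)] [∀ i, MeasurableSingletonClass (β i)]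
    {V : W → α} {f : ∀ i, α → β i} (hf : Function.Bijective fun a i => f i a)
    {s : ∀ i, Set (β i)} (hV : IsUniformlyDistributed P V {a | ∀ i, f i a ∈ s i}) :
    iIndepFun (fun i w => f i (V w)) P ∧
      ∀ i, IsUniformlyDistributed P (fun w => f i (V w)) (s i) := by
  have hset : {a | ∀ i, f i a ∈ s i} = (fun a i => f i a) ⁻¹' Set.univ.pi s := by
    ext; simp
  rw [hset] at hV
  have hpi := hV.comp_bijective hf
  have hne := Set.univ_pi_nonempty_iff.1 hpi.nonempty
  have : ∀ i, IsProbabilityMeasure (uniformOn (s i)) := fun i =>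
    isProbabilityMeasure_uniformOn (s i).toFinite (hne i)
  have hm : ∀ i, Measurable fun w => f i (V w) := fun i => (measurable_of_finite (f i)).comp hV.1
  have hmap : P.map (fun w i => f i (V w)) = Measure.pi fun i => uniformOn (s i) := by
    rw [← uniformOn_pi_eq]; exact hpi.2
  have hlaw : ∀ i, P.map (fun w => f i (V w)) = uniformOn (s i) := by
    intro i
    have := congrArg (Measure.map (Function.eval i)) hmap
    rw [Measure.map_map (measurable_pi_apply i) hpi.1,
      (measurePreserving_eval _ i).map_eq] at this
    exact this
  refine ⟨(iIndepFun_iff_map_fun_eq_pi_map fun i => (hm i).aemeasurable).2 ?_,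
    fun i => ⟨hm i, hlaw i⟩⟩
  simp only [hmap, hlaw]

end Uniform

instance matrixFinite {k l R : Type*} [Finite k] [Finite l] [Finite R] : Finite (Matrix k l R) :=
  inferInstanceAs (Finite (k → l → R))

instance matrixMeasurableSingletonClass {k l R : Type*} :
    MeasurableSingletonClass (Matrix k l R) := ⟨fun _ => trivial⟩

/-! ### The decomposition of the message space -/

theorem mk_mem_span_cofactor_iff {T : Type*} [CommRing T] [IsDomain T] {a b c : T} (hb : b ≠ 0)
    (hc : c * b = a) (x : T) :
    Ideal.Quotient.mk (Ideal.span {a}) x ∈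
      Ideal.span {r | ∃ c : T, c * b = a ∧ r = Ideal.Quotient.mk (Ideal.span {a}) c} ↔ c ∣ x := by
  have hset : {r | ∃ c : T, c * b = a ∧ r = Ideal.Quotient.mk (Ideal.span {a}) c} =
      {Ideal.Quotient.mk (Ideal.span {a}) c} := by
    ext r
    constructor
    · rintro ⟨c', hc', rfl⟩
      rw [mul_right_cancel₀ hb (hc'.trans hc.symm)]
      rfl
    · rintro rfl
      exact ⟨c, hc, rfl⟩
  rw [hset, Ideal.mem_span_singleton]
  constructor
  · rintro ⟨y, hy⟩
    obtain ⟨y, rfl⟩ := Ideal.Quotient.mk_surjective y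
    rw [← map_mul, Ideal.Quotient.eq, Ideal.mem_span_singleton] at hy
    exact (dvd_sub_left (dvd_mul_right c y)).1 ((Dvd.intro b hc).trans hy)
  · exact fun h => map_dvd _ h

theorem mem_packetModule_iff {T : Type*} [CommRing T] {m : ℕ} {a : T} {b : Fin m → T}
    {x : Fin m → T ⧸ Ideal.span {a}} : x ∈ packetModule a b ↔ ∀ j, x j ∈
      Ideal.span {r | ∃ c : T, c * b j = a ∧ r = Ideal.Quotient.mk (Ideal.span {a}) c} := by
  simp [packetModule, Submodule.mem_pi]

namespace MessageSpace

theorem projMatrix_mul_add {T : Type*} [CommRing T] {m L : ℕ} [NeZero m]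
    (S : MessageSpace T m L) {N n k : ℕ} (ℓ : Fin L) (A : Matrix (Fin N) (Fin n) S.R)
    (X : Matrix (Fin n) (Fin k) S.R) (Z : Matrix (Fin N) (Fin k) S.R) :
    S.projMatrix ℓ (A * X + Z) = S.projMatrix ℓ A * S.projMatrix ℓ X + S.projMatrix ℓ Z := by
  simp only [projMatrix]
  rw [Matrix.map_add _ (map_add _), Matrix.map_mul]

theorem d_ne_zero {T : Type*} [CommRing T] {m L : ℕ} [NeZero m] (S : MessageSpace T m L) (j : Fin m) : S.d j ≠ 0 := fun h =>
  S.d_zero_ne_zero (zero_dvd_iff.1 (h ▸ S.d_dvd 0 j (Fin.zero_le j)))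

variable {T : Type*} [CommRing T] [IsDomain T] [IsPrincipalIdealRing T] {m L : ℕ} [NeZero m]
  (S : MessageSpace T m L)

theorem isCoprime_p {ℓ ℓ' : Fin L} (h : ℓ ≠ ℓ') : IsCoprime (S.p ℓ) (S.p ℓ') :=
  (S.prime_p ℓ).coprime_iff_not_dvd.2 fun hd =>
    S.not_associated ℓ ℓ' h ((S.prime_p ℓ).dvd_prime_iff_associated (S.prime_p ℓ') |>.1 hd)

theorem prod_pow_dvd_iff (k : Fin L → ℕ) (x : T) :
    ∏ ℓ, S.p ℓ ^ k ℓ ∣ x ↔ ∀ ℓ, S.p ℓ ^ k ℓ ∣ x :=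
  ⟨fun h ℓ => (Finset.dvd_prod_of_mem (fun ℓ => S.p ℓ ^ k ℓ) (Finset.mem_univ ℓ)).trans h,
    Fintype.prod_dvd_of_coprime fun _ _ h => (S.isCoprime_p h).pow⟩

theorem e_le_e_zero (ℓ : Fin L) (j : Fin m) : S.e ℓ j ≤ S.e ℓ 0 := by
  have h : S.p ℓ ^ S.e ℓ j ∣ ∏ i, S.p i ^ S.e i 0 :=
    ((Finset.dvd_prod_of_mem (fun i => S.p i ^ S.e i j) (Finset.mem_univ ℓ)).trans
      (S.associated_prod j).symm.dvd).trans
      ((S.d_dvd 0 j (Fin.zero_le j)).trans (S.associated_prod 0).dvd)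
  rw [← Finset.mul_prod_erase _ _ (Finset.mem_univ ℓ)] at h
  have hc : IsCoprime (S.p ℓ ^ S.e ℓ j) (∏ i ∈ Finset.univ.erase ℓ, S.p i ^ S.e i 0) :=
    IsCoprime.prod_right fun i hi => (S.isCoprime_p (Finset.ne_of_mem_erase hi).symm).pow
  exact (pow_dvd_pow_iff (S.prime_p ℓ).ne_zero (S.prime_p ℓ).not_isUnit).1 (hc.dvd_of_dvd_mul_right h)

theorem exists_cofactor (j : Fin m) :
    ∃ c, c * S.d j = S.d 0 ∧ Associated c (∏ ℓ, S.p ℓ ^ (S.e ℓ 0 - S.e ℓ j)) := by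
  obtain ⟨c, hc⟩ := S.d_dvd 0 j (Fin.zero_le j)
  refine ⟨c, by rw [mul_comm, hc], ?_⟩
  have h : Associated (c * S.d j)
      ((∏ ℓ, S.p ℓ ^ (S.e ℓ 0 - S.e ℓ j)) * ∏ ℓ, S.p ℓ ^ S.e ℓ j) := by
    rw [← Finset.prod_mul_distrib, mul_comm, ← hc]
    simpa only [← pow_add, Nat.sub_add_cancel (S.e_le_e_zero _ j)] using S.associated_prod 0
  exact h.of_mul_right (S.associated_prod j) (S.d_ne_zero j)

theorem mem_matricesOver_Ω_iff {k : ℕ} (X : Matrix (Fin k) (Fin m) S.R) :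
    X ∈ matricesOver S.Ω k ↔ ∀ ℓ, S.projMatrix ℓ X ∈ matricesOver (S.ΩSub ℓ) k := by
  have h : ∀ i j, (X.row i j ∈ Ideal.span {r | ∃ c : T, c * S.d j = S.d 0 ∧
        r = Ideal.Quotient.mk (Ideal.span {S.d 0}) c}) ↔
      ∀ ℓ, (S.projMatrix ℓ X).row i j ∈ Ideal.span {r | ∃ c : T,
        c * S.p ℓ ^ S.e ℓ j = S.p ℓ ^ S.e ℓ 0 ∧
          r = Ideal.Quotient.mk (Ideal.span {S.p ℓ ^ S.e ℓ 0}) c} := by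
    intro i j
    obtain ⟨x, hx⟩ := Ideal.Quotient.mk_surjective (X i j)
    obtain ⟨c, hc, hca⟩ := S.exists_cofactor j
    have hp : ∀ ℓ, (S.projMatrix ℓ X).row i j = Ideal.Quotient.mk _ x := fun ℓ => by
      simp only [Matrix.row, projMatrix, Matrix.map_apply, ← hx]
      rfl
    have hX : X.row i j = Ideal.Quotient.mk _ x := hx.symm
    simp only [hp, hX]
    rw [mk_mem_span_cofactor_iff (S.d_ne_zero j) hc, hca.dvd_iff_dvd_left, S.prod_pow_dvd_iff]
    refine forall_congr' fun ℓ => ?_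
    rw [mk_mem_span_cofactor_iff (pow_ne_zero _ (S.prime_p ℓ).ne_zero)]
    rw [← pow_add, Nat.sub_add_cancel (S.e_le_e_zero ℓ j)]
  simp only [matricesOver, Set.mem_ofPred_eq, Ω, ΩSub, mem_packetModule_iff, h]
  exact ⟨fun H ℓ i j => H i j ℓ, fun H i j ℓ => H ℓ i j⟩

theorem bijective_proj : Function.Bijective fun (x : S.R) ℓ => S.proj ℓ x := by
  constructor
  · intro x y hxy
    obtain ⟨x, rfl⟩ := Ideal.Quotient.mk_surjective x
    obtain ⟨y, rfl⟩ := Ideal.Quotient.mk_surjective y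
    rw [Ideal.Quotient.eq, Ideal.mem_span_singleton, (S.associated_prod 0).dvd_iff_dvd_left,
      S.prod_pow_dvd_iff fun ℓ => S.e ℓ 0]
    intro ℓ
    rw [← Ideal.mem_span_singleton, ← Ideal.Quotient.eq]
    exact congrFun hxy ℓ
  · intro y
    choose z hz using fun ℓ => Ideal.Quotient.mk_surjective (y ℓ)
    obtain ⟨x, hx⟩ := Ideal.exists_forall_sub_mem_ideal
      (I := fun ℓ => Ideal.span {S.p ℓ ^ S.e ℓ 0})
      (fun i j h => (Ideal.isCoprime_span_singleton_iff _ _).2 (S.isCoprime_p h).pow) z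
    refine ⟨Ideal.Quotient.mk _ x, funext fun ℓ => ?_⟩
    rw [← hz]
    exact Ideal.Quotient.eq.2 (hx ℓ)

theorem bijective_projMatrix (k l : ℕ) :
    Function.Bijective fun (X : Matrix (Fin k) (Fin l) S.R) ℓ => S.projMatrix ℓ X := by
  constructor
  · intro X Y h
    ext i j
    exact S.bijective_proj.1 (funext fun ℓ => congrFun (congrFun (congrFun h ℓ) i) j)
  · intro Y
    choose x hx using fun i j => S.bijective_proj.2 fun ℓ => Y ℓ i j
    refine ⟨Matrix.of x, funext fun ℓ => ?_⟩
    ext i j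
    exact congrFun (hx i j) ℓ

theorem bijOn_projMatrix (k : ℕ) :
    Set.BijOn (fun (X : Matrix (Fin k) (Fin m) S.R) ℓ => S.projMatrix ℓ X)
      (matricesOver S.Ω k) (Set.univ.pi fun ℓ => matricesOver (S.ΩSub ℓ) k) := by
  refine ⟨fun X hX ℓ _ => (S.mem_matricesOver_Ω_iff X).1 hX ℓ, (S.bijective_projMatrix k m).1.injOn,
    fun Y hY => ?_⟩
  obtain ⟨X, rfl⟩ := (S.bijective_projMatrix k m).2 Y
  exact ⟨X, (S.mem_matricesOver_Ω_iff X).2 fun ℓ => hY ℓ trivial, rfl⟩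

/-- The decomposition of packet matrices, as an equivalence. -/
def packetEquiv (k : ℕ) : matricesOver S.Ω k ≃ ∀ ℓ, matricesOver (S.ΩSub ℓ) k :=
  Equiv.ofBijective (fun X ℓ => ⟨S.projMatrix ℓ X.1, (S.mem_matricesOver_Ω_iff X.1).1 X.2 ℓ⟩) <| by
    constructor
    · intro X Y h
      exact Subtype.ext ((S.bijective_projMatrix k m).1 (funext fun ℓ =>
        congrArg Subtype.val (congrFun h ℓ)))
    · intro Y
      obtain ⟨X, hX⟩ := (S.bijective_projMatrix k m).2 fun ℓ => (Y ℓ).1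
      refine ⟨⟨X, (S.mem_matricesOver_Ω_iff X).2 fun ℓ => ?_⟩, funext fun ℓ =>
        Subtype.ext (congrFun hX ℓ)⟩
      rw [show S.projMatrix ℓ X = (Y ℓ).1 from congrFun hX ℓ]
      exact (Y ℓ).2

theorem bijective_projMatrix_pair (N n : ℕ) : Function.Bijective
    fun (v : Matrix (Fin N) (Fin n) S.R × Matrix (Fin N) (Fin m) S.R) ℓ =>
      (S.projMatrix ℓ v.1, S.projMatrix ℓ v.2) := by
  constructor
  · intro u v h
    exact Prod.ext
      ((S.bijective_projMatrix N n).1 (funext fun ℓ => congrArg Prod.fst (congrFun h ℓ)))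
      ((S.bijective_projMatrix N m).1 (funext fun ℓ => congrArg Prod.snd (congrFun h ℓ)))
  · intro v
    obtain ⟨a, ha⟩ := (S.bijective_projMatrix N n).2 fun ℓ => (v ℓ).1
    obtain ⟨z, hz⟩ := (S.bijective_projMatrix N m).2 fun ℓ => (v ℓ).2
    exact ⟨(a, z), funext fun ℓ => Prod.ext (congrFun ha ℓ) (congrFun hz ℓ)⟩

end MessageSpace

theorem mul_add_mem_matricesOver {R : Type*} [CommRing R] {m N n : ℕ}
    {M : Submodule R (Fin m → R)} (A : Matrix (Fin N) (Fin n) R) {X : Matrix (Fin n) (Fin m) R}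
    (hX : X ∈ matricesOver M n) {Z : Matrix (Fin N) (Fin m) R} (hZ : Z ∈ matricesOver M N) :
    A * X + Z ∈ matricesOver M N := by
  intro i
  have h : (A * X + Z).row i = ∑ k, A i k • X.row k + Z.row i := by
    ext j
    simp [Matrix.row, Matrix.mul_apply]
  rw [h]
  exact M.add_mem (M.sum_mem fun k _ => M.smul_mem _ (hX k)) (hZ i)

theorem isDMC_matrixChannel {R : Type*} [CommRing R] [Finite R] {m N n : ℕ} {W : Type*}
    [MeasurableSpace W] (M : Submodule R (Fin m → R)) (P : Measure W) [IsProbabilityMeasure P]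
    {A : W → Matrix (Fin N) (Fin n) R} {Z : W → Matrix (Fin N) (Fin m) R} (hA : Measurable A)
    (hZ : Measurable Z) (hZM : ∀ᵐ w ∂P, Z w ∈ matricesOver M N) :
    IsDMC (matrixChannel M P A Z) := by
  refine ⟨fun _ _ => measureReal_nonneg, fun X => ?_⟩
  have hm : ∀ Y : matricesOver M N, MeasurableSet {w | A w * X.1 + Z w = Y.1} := fun Y =>
    (hA.prodMk hZ) (Set.toFinite
      {a : Matrix (Fin N) (Fin n) R × Matrix (Fin N) (Fin m) R | a.1 * X.1 + a.2 = Y.1}).measurableSet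
  simp only [matrixChannel]
  rw [← measureReal_biUnion_finset (fun Y _ Y' _ h => ?_) fun Y _ => hm Y]
  · have hall : ∀ᵐ w ∂P, w ∈ ⋃ Y ∈ (Finset.univ : Finset (matricesOver M N)),
        {w | A w * X.1 + Z w = Y.1} := by
      filter_upwards [hZM] with w hw
      simpa using mul_add_mem_matricesOver (A w) X.2 hw
    have hone : P (⋃ Y ∈ (Finset.univ : Finset (matricesOver M N)),
        {w | A w * X.1 + Z w = Y.1}) = 1 :=
      (measure_congr (Filter.eventuallyEq_univ.2 hall)).trans measure_univ
    rw [measureReal_def, hone, ENNReal.toReal_one]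
  · refine Set.disjoint_left.2 fun w hw hw' => h (Subtype.ext ?_)
    exact hw.symm.trans hw'

/-- If the pairs of projections are independent, the channel is the product of the sub-channels. -/
theorem matrixChannel_eq_productChannel {T : Type*} [CommRing T] [IsDomain T]
    [IsPrincipalIdealRing T] {m L : ℕ} [NeZero m] (S : MessageSpace T m L) {N n : ℕ}
    {W : Type*} [MeasurableSpace W] (P : Measure W)
    (A : W → Matrix (Fin N) (Fin n) S.R) (Z : W → Matrix (Fin N) (Fin m) S.R)
    (h : iIndepFun (fun ℓ w => (S.projMatrix ℓ (A w), S.projMatrix ℓ (Z w))) P)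
    (X : matricesOver S.Ω n) (Y : matricesOver S.Ω N)
    (X' : ∀ ℓ, matricesOver (S.ΩSub ℓ) n) (Y' : ∀ ℓ, matricesOver (S.ΩSub ℓ) N)
    (hX : ∀ ℓ, (X' ℓ).1 = S.projMatrix ℓ X.1) (hY : ∀ ℓ, (Y' ℓ).1 = S.projMatrix ℓ Y.1) :
    matrixChannel S.Ω P A Z X Y = productChannel (fun ℓ => matrixChannel (S.ΩSub ℓ) P
      (fun w => S.projMatrix ℓ (A w)) (fun w => S.projMatrix ℓ (Z w))) X' Y' := by
  have hset : {w | A w * X.1 + Z w = Y.1} = ⋂ ℓ ∈ Finset.univ,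
      (fun w => (S.projMatrix ℓ (A w), S.projMatrix ℓ (Z w))) ⁻¹'
        {v | v.1 * (X' ℓ).1 + v.2 = (Y' ℓ).1} := by
    ext w
    simp only [Finset.mem_univ, Set.iInter_true, Set.mem_iInter, Set.mem_preimage,
      Set.mem_ofPred_eq, hX, hY, ← S.projMatrix_mul_add]
    rw [← (S.bijective_projMatrix N m).1.eq_iff, funext_iff]
  simp only [matrixChannel, productChannel, measureReal_def]
  rw [hset, h.measure_inter_preimage_eq_mul Finset.univ
    fun ℓ _ => (Set.toFinite _).measurableSet, ENNReal.toReal_prod]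
  rfl

end

theorem mainTheorem5 {T : Type*} [CommRing T] [IsDomain T] [IsPrincipalIdealRing T]
    {m L : ℕ} [NeZero m] (S : MessageSpace T m L) {N n t : ℕ} (hn : n ≤ N)
    {W : Type*} [MeasurableSpace W] (P : Measure W) [IsProbabilityMeasure P]
    (A : W → Matrix (Fin N) (Fin n) S.R) (Z : W → Matrix (Fin N) (Fin m) S.R)
    (hA : IsUniformlyDistributed P A {a | S.HasRank a (min N n)})
    (hZ : IsUniformlyDistributed P Z {z | z ∈ matricesOver S.Ω N ∧ S.HasRank z t})
    (hAZ : IndepFun A Z P) :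
    -- the projections decompose packet matrices over the message space
    (∀ k : ℕ, Set.BijOn (fun (X : Matrix (Fin k) (Fin m) S.R) ℓ => S.projMatrix ℓ X)
      (matricesOver S.Ω k) (Set.univ.pi fun ℓ => matricesOver (S.ΩSub ℓ) k)) ∧
    -- the sub-channel equations
    (∀ ℓ w (X : Matrix (Fin n) (Fin m) S.R), S.projMatrix ℓ (A w * X + Z w) =
      S.projMatrix ℓ (A w) * S.projMatrix ℓ X + S.projMatrix ℓ (Z w)) ∧
    -- the sub-channels are independent, with the stated distributions
    iIndepFun (fun ℓ w => (S.projMatrix ℓ (A w), S.projMatrix ℓ (Z w))) P ∧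
    (∀ ℓ, IsUniformlyDistributed P (fun w => S.projMatrix ℓ (A w))
      {a | HasChainRank a (min N n)}) ∧
    (∀ ℓ, IsUniformlyDistributed P (fun w => S.projMatrix ℓ (Z w))
      {z | z ∈ matricesOver (S.ΩSub ℓ) N ∧ HasChainRank z t}) ∧
    (∀ ℓ, IndepFun (fun w => S.projMatrix ℓ (A w)) (fun w => S.projMatrix ℓ (Z w)) P) ∧
    -- the channel is the product of the sub-channels
    IsDMC (matrixChannel S.Ω P A Z) ∧
    (∀ ℓ, IsDMC (matrixChannel (S.ΩSub ℓ) P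
      (fun w => S.projMatrix ℓ (A w)) (fun w => S.projMatrix ℓ (Z w)))) ∧
    (∀ (X : matricesOver S.Ω n) (Y : matricesOver S.Ω N)
      (X' : ∀ ℓ, matricesOver (S.ΩSub ℓ) n) (Y' : ∀ ℓ, matricesOver (S.ΩSub ℓ) N),
      (∀ ℓ, (X' ℓ).1 = S.projMatrix ℓ X.1) → (∀ ℓ, (Y' ℓ).1 = S.projMatrix ℓ Y.1) →
      matrixChannel S.Ω P A Z X Y =
        productChannel (fun ℓ => matrixChannel (S.ΩSub ℓ) P
          (fun w => S.projMatrix ℓ (A w)) (fun w => S.projMatrix ℓ (Z w))) X' Y') ∧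
    -- all the capacities are attained maxima, and the capacity is additive
    IsGreatest (informationValues (matrixChannel S.Ω P A Z))
      (channelCapacity (matrixChannel S.Ω P A Z)) ∧
    (∀ ℓ, IsGreatest
      (informationValues (matrixChannel (S.ΩSub ℓ) P
        (fun w => S.projMatrix ℓ (A w)) (fun w => S.projMatrix ℓ (Z w))))
      (channelCapacity (matrixChannel (S.ΩSub ℓ) P
        (fun w => S.projMatrix ℓ (A w)) (fun w => S.projMatrix ℓ (Z w))))) ∧
    channelCapacity (productChannel (fun ℓ => matrixChannel (S.ΩSub ℓ) P
        (fun w => S.projMatrix ℓ (A w)) (fun w => S.projMatrix ℓ (Z w)))) =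
      channelCapacity (matrixChannel S.Ω P A Z) ∧
    channelCapacity (matrixChannel S.Ω P A Z) =
      ∑ ℓ, channelCapacity (matrixChannel (S.ΩSub ℓ) P
        (fun w => S.projMatrix ℓ (A w)) (fun w => S.projMatrix ℓ (Z w))) := by
  have hZ' : IsUniformlyDistributed P Z {z | ∀ ℓ, S.projMatrix ℓ z ∈
      {z | z ∈ matricesOver (S.ΩSub ℓ) N ∧ HasChainRank z t}} := by
    convert! hZ using 1
    ext z
    simp only [Set.mem_ofPred_eq, S.mem_matricesOver_Ω_iff, MessageSpace.HasRank, forall_and]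
  have hAc := hA.components (f := fun ℓ => S.projMatrix ℓ) (S.bijective_projMatrix N n)
    (s := fun ℓ => {a | HasChainRank a (min N n)})
  have hZc := hZ'.components (S.bijective_projMatrix N m)
  have hpair : IsUniformlyDistributed P (fun w => (A w, Z w))
      {v | ∀ ℓ, (S.projMatrix ℓ v.1, S.projMatrix ℓ v.2) ∈ {a | HasChainRank a (min N n)} ×ˢ
        {z | z ∈ matricesOver (S.ΩSub ℓ) N ∧ HasChainRank z t}} := by
    convert! hA.prodMk hZ' hAZ using 1
    ext v
    simp only [Set.mem_prod, Set.mem_ofPred_eq, MessageSpace.HasRank, forall_and]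
  have hind := (hpair.components (S.bijective_projMatrix_pair N n)).1
  have hdmc := isDMC_matrixChannel S.Ω P hA.1 hZ.1 (hZ.ae_mem.mono fun w hw => hw.1)
  have hdmcs : ∀ ℓ, IsDMC (matrixChannel (S.ΩSub ℓ) P
      (fun w => S.projMatrix ℓ (A w)) (fun w => S.projMatrix ℓ (Z w))) := fun ℓ =>
    isDMC_matrixChannel _ P (hAc.2 ℓ).1 (hZc.2 ℓ).1 ((hZc.2 ℓ).ae_mem.mono fun w hw => hw.1)
  have hprod := matrixChannel_eq_productChannel S P A Z hind
  have hne : ∀ {R : Type _} [CommRing R] (M : Submodule R (Fin m → R)),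
      Nonempty (matricesOver M n) := fun M => ⟨⟨0, fun _ => M.zero_mem⟩⟩
  have : Nonempty (matricesOver S.Ω n) := hne _
  have : ∀ ℓ, Nonempty (matricesOver (S.ΩSub ℓ) n) := fun ℓ => hne _
  have hcap : channelCapacity (productChannel (fun ℓ => matrixChannel (S.ΩSub ℓ) P
      (fun w => S.projMatrix ℓ (A w)) (fun w => S.projMatrix ℓ (Z w)))) =
      channelCapacity (matrixChannel S.Ω P A Z) := by
    rw [channelCapacity, channelCapacity,
      ← informationValues_equiv (S.packetEquiv n) (S.packetEquiv N)]
    congr 2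
    funext X Y
    exact (hprod X Y _ _ (fun _ => rfl) fun _ => rfl).symm
  refine ⟨S.bijOn_projMatrix, fun ℓ w X => S.projMatrix_mul_add ℓ _ _ _, hind, hAc.2, hZc.2,
    fun ℓ => hAZ.comp (measurable_of_finite (S.projMatrix ℓ)) (measurable_of_finite (S.projMatrix ℓ)),
    hdmc, hdmcs, hprod,
    isGreatest_channelCapacity hdmc, fun ℓ => isGreatest_channelCapacity (hdmcs ℓ), hcap, ?_⟩
  rw [← hcap, channelCapacity_productChannel hdmcs]
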